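/- All rings are commutative. For a Noetherian local ring $S$ with residue field $k$ and a complex $X$ of $S$-modules put $$\operatorname{depth}_S X=\inf\{i\in\mathbb Z\mid \operatorname{Ext}^i_S(k,X)\neq 0\},\qquad \operatorname{Ext}^i_S(k,X)=\operatorname{Hom}_{D(S)}(k,X[i])$$ (with $\inf\emptyset=+\infty$); modules are viewed as complexes concentrated in degree $0$. For a complex $X$ of $S$-modules, say that *derived $(\mathbf{ldep})$ holds over $S$ for $X$* if $$\operatorname{depth}_S(X\otimes^{\mathbf L}_S Y)+\operatorname{depth}_S S\ \ge\ \operatorname{depth}_S X+\operatorname{depth}_S Y$$ for every complex $Y$ of finitely generated $S$-modules such that $Y$ and $X\otimes^{\mathbf L}_S Y$ have bounded homology; that *derived $(\mathbf{rdep})$ holds over $S$ for $X$* if under the same conditions the opposite inequality $\le$ holds; and that *derived $(\mathbf{dep})$ holds over $S$ for $X$* if both do. The ring $S$ *satisfies derived $(\mathbf{ldep})$*, $(\mathbf{rdep})$, or $(\mathbf{dep})$ if the corresponding condition holds over $S$ for every complex $X$ of finitely generated $S$-modules with bounded homology. **Theorem.** Let $R$ be a Noetherian local ring, let $M$ and $N$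 be finitely generated $R$-modules, and put $q_R(M,N)=\sup\{i\mid \operatorname{Tor}^R_i(M,N)\neq 0\}$ and $$s_R(M,N)=\sup\{\operatorname{depth} R_{\mathfrak p}-\operatorname{depth}_{R_{\mathfrak p}}M_{\mathfrak p}-\operatorname{depth}_{R_{\mathfrak p}}N_{\mathfrak p}\mid \mathfrak p\in\operatorname{Supp}M\cap\operatorname{Supp}N\},$$ where $\sup\emptyset=-\infty$. Suppose $q_R(M,N)<\infty$. 1. If for every $\mathfrak p\in\operatorname{Spec}R$ derived $(\mathbf{ldep})$ holds over $R_{\mathfrak p}$ for the module $M_{\mathfrak p}$, then $q_R(M,N)\le s_R(M,N)$. 2. If for every $\mathfrak p\in\operatorname{Spec}R$ derived $(\mathbf{rdep})$ holds over $R_{\mathfrak p}$ for the module $M_{\mathfrak p}$, then $q_R(M,N)\ge s_R(M,N)$. 3. If for every $\mathfrak p\in\operatorname{Spec}R$ derived $(\mathbf{dep})$ holds over $R_{\mathfrak p}$ for the module $M_{\mathfrak p}$, then $q_R(M,N)= s_R(M,N)$. In particular, if every ring $R_{\mathfrak p}$ ($\mathfrak p\in\operatorname{Spec}R$) satisfies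 derived $(\mathbf{ldep})$, then $q_R(M,N)\le s_R(M,N)$; if every $R_{\mathfrak p}$ satisfies derived $(\mathbf{rdep})$, then $q_R(M,N)\ge s_R(M,N)$; and if every $R_{\mathfrak p}$ satisfies derived $(\mathbf{dep})$, then $q_R(M,N)=s_R(M,N)$. -/

import Mathlib

open CategoryTheory

universe u

noncomputable section

/-! Complexes of `R`-modules are written cohomologically, `Xⁱ = X₋ᵢ`: they are objects of
`CochainComplex (ModuleCat R) ℤ`.  A module is identified with the complex concentrated in
degree `0`. -/

/-- The module `M`, viewed as a complex concentrated in degree `0`. -/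
abbrev moduleComplex (R : Type u) [CommRing R] (M : Type u) [AddCommGroup M] [Module R M] :
    CochainComplex (ModuleCat.{u} R) ℤ :=
  (CochainComplex.singleFunctor (ModuleCat.{u} R) 0).obj (ModuleCat.of R M)

section Depth

attribute [local instance] HasDerivedCategory.standard

/-- `Extⁱ_R(A, X)` for a module `A` and a complex `X`: the group of morphisms `A ⟶ X[i]` in the
derived category of `R`-modules. -/
def HyperExt (R : Type u) [CommRing R] (A : ModuleCat.{u} R)
    (X : CochainComplex (ModuleCat.{u} R) ℤ) (i : ℤ) : Type (u + 1) :=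
  (DerivedCategory.Q.obj ((CochainComplex.singleFunctor (ModuleCat.{u} R) 0).obj A)) ⟶
    (shiftFunctor (DerivedCategory (ModuleCat.{u} R)) i).obj (DerivedCategory.Q.obj X)

instance (R : Type u) [CommRing R] (A : ModuleCat.{u} R)
    (X : CochainComplex (ModuleCat.{u} R) ℤ) (i : ℤ) : AddCommGroup (HyperExt R A X i) :=
  inferInstanceAs (AddCommGroup
    ((DerivedCategory.Q.obj ((CochainComplex.singleFunctor (ModuleCat.{u} R) 0).obj A)) ⟶
      (shiftFunctor (DerivedCategory (ModuleCat.{u} R)) i).obj (DerivedCategory.Q.obj X)))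

end Depth

/-- The depth of a complex `X` over a local ring `R` with residue field `k`:
`depth_R X = inf {i | Extⁱ_R(k, X) ≠ 0}`, with value `⊤` if there is no such `i`. -/
def complexDepth (R : Type u) [CommRing R] [IsLocalRing R]
    (X : CochainComplex (ModuleCat.{u} R) ℤ) : EReal :=
  ⨅ (i : ℤ) (_ : Nontrivial (HyperExt R (ModuleCat.of R (IsLocalRing.ResidueField R)) X i)),
    ((i : ℝ) : EReal)

/-- The depth of a module over a local ring. -/
def moduleDepth (R : Type u) [CommRing R] [IsLocalRing R]
    (M : Type u) [AddCommGroup M] [Module R M] : EReal :=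
  complexDepth R (moduleComplex R M)

/-- `q_R(M, N) = sup {i | Tor_i^R(M, N) ≠ 0}`, with value `⊥` if all `Tor_i^R(M, N)` vanish. -/
def torSup (R : Type u) [CommRing R] (M N : Type u) [AddCommGroup M] [Module R M]
    [AddCommGroup N] [Module R N] : EReal :=
  ⨆ (i : ℕ) (_ : Nontrivial
    (((Tor (ModuleCat.{u} R) i).obj (ModuleCat.of R M)).obj (ModuleCat.of R N))),
    ((i : ℝ) : EReal)

/-- A complex all of whose terms are finitely generated modules. -/
def HasFGTerms {R : Type u} [CommRing R] (X : CochainComplex (ModuleCat.{u} R) ℤ) : Prop :=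
  ∀ i : ℤ, Module.Finite R (X.X i)

/-- A complex whose homology vanishes outside a bounded range of degrees. -/
def HasBoundedHomology {R : Type u} [CommRing R]
    (X : CochainComplex (ModuleCat.{u} R) ℤ) : Prop :=
  ∃ a b : ℤ, ∀ i : ℤ, i < a ∨ b < i → X.ExactAt i

/-- A projective resolution of a complex `X`: a quasi-isomorphism to `X` from a complex of
projective modules which is zero in all sufficiently large cohomological degrees
(it is unbounded only on the side of large homological degrees). -/
structure ComplexProjectiveResolution {R : Type u} [CommRing R]
    (X : CochainComplex (ModuleCat.{u} R) ℤ) where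
  /-- the resolving complex -/
  complex : CochainComplex (ModuleCat.{u} R) ℤ
  /-- the comparison map -/
  π : complex ⟶ X
  projective : ∀ i : ℤ, Projective (complex.X i)
  bounded : ∃ b : ℤ, ∀ i : ℤ, b < i → Limits.IsZero (complex.X i)
  quasiIso : QuasiIso π

/-- The derived tensor product `X ⊗ᴸ_R Y`, computed from a projective resolution `P` of `X` as
the total tensor product complex `P ⊗_R Y`.  Up to quasi-isomorphism it does not depend
on `P`. -/
def ComplexProjectiveResolution.derivedTensor {R : Type u} [CommRing R]
    {X : CochainComplex (ModuleCat.{u} R) ℤ} (P : ComplexProjectiveResolution X)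
    (Y : CochainComplex (ModuleCat.{u} R) ℤ) : CochainComplex (ModuleCat.{u} R) ℤ :=
  HomologicalComplex.tensorObj P.complex Y

/-- Derived (ldep) over `R` for the complex `X`: for every complex `Y` of finitely generated
modules such that `Y` and `X ⊗ᴸ Y` have bounded homology,
`depth (X ⊗ᴸ Y) + depth R ≥ depth X + depth Y`. -/
def DerivedLdepFor (R : Type u) [CommRing R] [IsLocalRing R]
    (X : CochainComplex (ModuleCat.{u} R) ℤ) : Prop :=
  ∀ Y : CochainComplex (ModuleCat.{u} R) ℤ, HasFGTerms Y → HasBoundedHomology Y →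
    ∀ P : ComplexProjectiveResolution X, HasBoundedHomology (P.derivedTensor Y) →
      complexDepth R (P.derivedTensor Y) + moduleDepth R R ≥ complexDepth R X + complexDepth R Y

/-- Derived (rdep) over `R` for the complex `X`: for every complex `Y` of finitely generated
modules such that `Y` and `X ⊗ᴸ Y` have bounded homology,
`depth (X ⊗ᴸ Y) + depth R ≤ depth X + depth Y`. -/
def DerivedRdepFor (R : Type u) [CommRing R] [IsLocalRing R]
    (X : CochainComplex (ModuleCat.{u} R) ℤ) : Prop :=
  ∀ Y : CochainComplex (ModuleCat.{u} R) ℤ, HasFGTerms Y → HasBoundedHomology Y →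
    ∀ P : ComplexProjectiveResolution X, HasBoundedHomology (P.derivedTensor Y) →
      complexDepth R (P.derivedTensor Y) + moduleDepth R R ≤ complexDepth R X + complexDepth R Y

/-- Derived (dep) over `R` for the complex `X`. -/
def DerivedDepFor (R : Type u) [CommRing R] [IsLocalRing R]
    (X : CochainComplex (ModuleCat.{u} R) ℤ) : Prop :=
  DerivedLdepFor R X ∧ DerivedRdepFor R X

/-- The local ring `R` satisfies derived (ldep). -/
def DerivedLdep (R : Type u) [CommRing R] [IsLocalRing R] : Prop :=
  ∀ X : CochainComplex (ModuleCat.{u} R) ℤ, HasFGTerms X → HasBoundedHomology X →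
    DerivedLdepFor R X

/-- The local ring `R` satisfies derived (rdep). -/
def DerivedRdep (R : Type u) [CommRing R] [IsLocalRing R] : Prop :=
  ∀ X : CochainComplex (ModuleCat.{u} R) ℤ, HasFGTerms X → HasBoundedHomology X →
    DerivedRdepFor R X

/-- The local ring `R` satisfies derived (dep). -/
def DerivedDep (R : Type u) [CommRing R] [IsLocalRing R] : Prop :=
  DerivedLdep R ∧ DerivedRdep R

/-- The module `M_𝔭` over `R_𝔭`, as a complex concentrated in degree `0`. -/
abbrev localizedComplex (R : Type u) [CommRing R] (M : Type u) [AddCommGroup M] [Module R M]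
    (p : PrimeSpectrum R) :
    CochainComplex (ModuleCat.{u} (Localization.AtPrime p.asIdeal)) ℤ :=
  moduleComplex (Localization.AtPrime p.asIdeal) (LocalizedModule p.asIdeal.primeCompl M)

/-- The depth of `M_𝔭` over `R_𝔭`. -/
def localDepth (R : Type u) [CommRing R] (M : Type u) [AddCommGroup M] [Module R M]
    (p : PrimeSpectrum R) : EReal :=
  moduleDepth (Localization.AtPrime p.asIdeal) (LocalizedModule p.asIdeal.primeCompl M)

/-- `sup {depth R_𝔭 - depth M_𝔭 - depth N_𝔭 | 𝔭 ∈ Supp M ∩ Supp N}`, all depths being taken over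
`R_𝔭`; the value is `⊥` if `Supp M ∩ Supp N` is empty. -/
def depthDefectSup (R : Type u) [CommRing R] (M N : Type u) [AddCommGroup M] [Module R M]
    [AddCommGroup N] [Module R N] : EReal :=
  ⨆ p ∈ Module.support R M ∩ Module.support R N,
    moduleDepth (Localization.AtPrime p.asIdeal) (Localization.AtPrime p.asIdeal)
      - localDepth R M p - localDepth R N p

end

/-! Let `P` resolve `M` and put `T = P ⊗ N`. Localization is exact and commutes with tensor
products, so `T_p` represents `M_p ⊗ᴸ N_p`, and its cohomology is that of `T`, localized. If `q` is
the largest index with nonzero `Tor`, every `T_p` has cohomology only in degrees at least `-q`,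
hence depth at least `-q` (`neg_torSup_le_complexDepth_derivedTensor`). Put into (rdep) at each `p`,
this bounds every depth defect by `q`.

For the other inequality let `p` be an associated prime of `H⁻q(T)`, the top `Tor`. Then `H⁻q(T_p)`
contains a nonzero element killed by the maximal ideal, that is, a nonzero map from the residue
field; since `-q` is the lowest degree, it survives to `Ext⁻q`, and `T_p` has depth at most `-q`
(`exists_complexDepth_derivedTensor_le`). Now (ldep) bounds the defect at `p` below by `q`. As
`depth R_p` is finite (`moduleDepth_self_ne_top`), so are the other two depths, which puts `p` in
both supports.

`Tor` is derived in its second argument while `T` resolves the first, so balancing is needed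
(`isZero_Tor_iff_exactAt`); only vanishing has to be compared, and syzygies suffice for that. -/

/-! ### Balancing of `Tor` by exchanging syzygies -/

section Balancing

variable {R : Type u} [CommRing R]

section Chase

variable {A B C D : Type*} [AddCommGroup A] [Module R A] [AddCommGroup B] [Module R B]
  [AddCommGroup C] [Module R C] [AddCommGroup D] [Module R D]

/-- By right exactness `C ⊗ N` is still the cokernel of `A ⊗ N → B ⊗ N`, so the failure of exactness
at `B ⊗ N` is the kernel of `C ⊗ N → D ⊗ N`. -/
lemma exact_rTensor_iff_injective (N : Type*) [AddCommGroup N] [Module R N]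
    {f : A →ₗ[R] B} {p : B →ₗ[R] C} (h : C →ₗ[R] D) (hfp : Function.Exact f p)
    (hp : Function.Surjective p) :
    Function.Exact (f.rTensor N) ((h ∘ₗ p).rTensor N) ↔ Function.Injective (h.rTensor N) := by
  have e := rTensor_exact N hfp hp
  have s := LinearMap.rTensor_surjective N hp
  rw [LinearMap.rTensor_comp]
  constructor
  · intro H
    rw [injective_iff_map_eq_zero]
    intro x hx
    obtain ⟨y, rfl⟩ := s x
    exact (e y).2 ((H y).1 hx)
  · intro H y
    rw [← e y, LinearMap.comp_apply, map_eq_zero_iff _ H]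

lemma exact_lTensor_iff_injective (N : Type*) [AddCommGroup N] [Module R N]
    {f : A →ₗ[R] B} {p : B →ₗ[R] C} (h : C →ₗ[R] D) (hfp : Function.Exact f p)
    (hp : Function.Surjective p) :
    Function.Exact (f.lTensor N) ((h ∘ₗ p).lTensor N) ↔ Function.Injective (h.lTensor N) := by
  have e := lTensor_exact N hfp hp
  have s := LinearMap.lTensor_surjective N hp
  rw [LinearMap.lTensor_comp]
  constructor
  · intro H
    rw [injective_iff_map_eq_zero]
    intro x hx
    obtain ⟨y, rfl⟩ := s x
    exact (e y).2 ((H y).1 hx)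
  · intro H y
    rw [← e y, LinearMap.comp_apply, map_eq_zero_iff _ H]

variable {A' B' C' : Type*} [AddCommGroup A'] [Module R A'] [AddCommGroup B'] [Module R B']
  [AddCommGroup C'] [Module R C']

lemma rTensor_lTensor_apply (f : A →ₗ[R] B) (g : A' →ₗ[R] B') (x : TensorProduct R A A') :
    f.rTensor B' (g.lTensor A x) = g.lTensor B (f.rTensor A' x) := by
  rw [← LinearMap.comp_apply, ← LinearMap.comp_apply, LinearMap.rTensor_comp_lTensor,
    LinearMap.lTensor_comp_rTensor]

/-- For short exact sequences `A → B → C` and `A' → B' → C'` with `B` flat, if `Tor₁(C, C')`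
computed from the first vanishes, then so does the one computed from the second. -/
lemma lTensor_injective_of_rTensor_injective [Module.Flat R B]
    {a : A →ₗ[R] B} {b : B →ₗ[R] C} (hab : Function.Exact a b) (hb : Function.Surjective b)
    {a' : A' →ₗ[R] B'} {b' : B' →ₗ[R] C'} (ha' : Function.Injective a')
    (hab' : Function.Exact a' b') (hb' : Function.Surjective b')
    (H : Function.Injective (a.rTensor C')) : Function.Injective (a'.lTensor C) := by
  rw [injective_iff_map_eq_zero]
  intro x hx
  obtain ⟨y, rfl⟩ := LinearMap.rTensor_surjective A' hb x
  -- The image of `y` in `B ⊗ B'` dies in `C ⊗ B'`, so it comes from some `z` in `A ⊗ B'`; by `H`,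
  -- `z` comes in turn from `A ⊗ A'`.
  rw [← rTensor_lTensor_apply] at hx
  obtain ⟨z, hz⟩ := (rTensor_exact B' hab hb _).1 hx
  have hz0 : b'.lTensor A z = 0 := by
    apply H
    rw [rTensor_lTensor_apply, hz, map_zero]
    exact (lTensor_exact B hab' hb').apply_apply_eq_zero y
  obtain ⟨w, rfl⟩ := (lTensor_exact A hab' hb' _).1 hz0
  rw [rTensor_lTensor_apply] at hz
  -- Flatness of `B` allows cancelling `a'`: `y` itself is the image of `w`, hence dies in `C ⊗ A'`.
  rw [← Module.Flat.lTensor_preserves_injective_linearMap (M := B) a' ha' hz]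
  exact (rTensor_exact A' hab hb).apply_apply_eq_zero w

lemma rTensor_injective_of_lTensor_injective [Module.Flat R B']
    {a : A →ₗ[R] B} {b : B →ₗ[R] C} (ha : Function.Injective a)
    (hab : Function.Exact a b) (hb : Function.Surjective b)
    {a' : A' →ₗ[R] B'} {b' : B' →ₗ[R] C'}
    (hab' : Function.Exact a' b') (hb' : Function.Surjective b')
    (H : Function.Injective (a'.lTensor C)) : Function.Injective (a.rTensor C') := by
  rw [LinearMap.lTensor_inj_iff_rTensor_inj] at H
  rw [← LinearMap.lTensor_inj_iff_rTensor_inj]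
  exact lTensor_injective_of_rTensor_injective hab' hb' ha hab hb H

/-- Shifting the first syzygy between the two arguments. -/
lemma rTensor_injective_iff_lTensor_injective_of_flat [Module.Flat R B] [Module.Flat R B']
    {a : A →ₗ[R] B} (ha : Function.Injective a) {a' : A' →ₗ[R] B'} (ha' : Function.Injective a') :
    Function.Injective (a.rTensor A') ↔ Function.Injective (a'.lTensor A) := by
  -- Followed by an injection into `B ⊗ B'`, both maps become `a ⊗ a'`.
  rw [← (Module.Flat.lTensor_preserves_injective_linearMap (M := B) a' ha').of_comp_iff,
    ← (Module.Flat.rTensor_preserves_injective_linearMap (M := B') a ha).of_comp_iff,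
    ← LinearMap.coe_comp, ← LinearMap.coe_comp, LinearMap.rTensor_comp_lTensor,
      LinearMap.lTensor_comp_rTensor]

end Chase

/-- Balancing of `Tor`, in terms of the syzygies `K j` and `Z j` of two flat resolutions
`P` and `Q`. -/
theorem lTensor_injective_iff_rTensor_injective_of_syzygies {K P Z Q : ℕ → Type u}
    [∀ i, AddCommGroup (K i)] [∀ i, Module R (K i)] [∀ i, AddCommGroup (P i)]
    [∀ i, Module R (P i)] [∀ i, AddCommGroup (Z i)] [∀ i, Module R (Z i)]
    [∀ i, AddCommGroup (Q i)] [∀ i, Module R (Q i)]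
    [∀ i, Module.Flat R (P i)] [∀ i, Module.Flat R (Q i)]
    {a : ∀ i, K (i + 1) →ₗ[R] P i} {b : ∀ i, P i →ₗ[R] K i}
    (ha : ∀ i, Function.Injective (a i)) (hab : ∀ i, Function.Exact (a i) (b i))
    (hb : ∀ i, Function.Surjective (b i))
    {a' : ∀ i, Z (i + 1) →ₗ[R] Q i} {b' : ∀ i, Q i →ₗ[R] Z i}
    (ha' : ∀ i, Function.Injective (a' i)) (hab' : ∀ i, Function.Exact (a' i) (b' i))
    (hb' : ∀ i, Function.Surjective (b' i)) (n : ℕ) :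
    Function.Injective ((a' n).lTensor (K 0)) ↔ Function.Injective ((a n).rTensor (Z 0)) := by
  have key (i j : ℕ) : Function.Injective ((a' i).lTensor (K j)) ↔
      Function.Injective ((a j).rTensor (Z i)) :=
    ⟨rTensor_injective_of_lTensor_injective (ha j) (hab j) (hb j) (hab' i) (hb' i),
      lTensor_injective_of_rTensor_injective (hab j) (hb j) (ha' i) (hab' i) (hb' i)⟩
  -- General `j` is needed for the induction: each step lowers `i` and raises `j`, keeping `i + j`
  -- fixed.
  suffices H : ∀ i j m : ℕ, m = i + j → (Function.Injective ((a' i).lTensor (K j)) ↔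
      Function.Injective ((a m).rTensor (Z 0))) from H n 0 n rfl
  intro i
  induction i with
  | zero => rintro j m rfl; rw [key, Nat.zero_add]
  | succ i ih =>
    intro j m hm
    rw [key, rTensor_injective_iff_lTensor_injective_of_flat (ha j) (ha' i)]
    exact ih (j + 1) m (by omega)

end Balancing

/-! ### Syzygies of a complex as opcycles -/

section Complexes

variable {R : Type u} [CommRing R] {ι : Type*} {c : ComplexShape ι}
  (X : HomologicalComplex (ModuleCat.{u} R) c)

lemma pOpcycles_surjective (i : ι) : Function.Surjective (X.pOpcycles i).hom :=
  (ModuleCat.epi_iff_surjective _).1 inferInstance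

lemma exact_d_pOpcycles {i j : ι} (hij : c.Rel i j) :
    Function.Exact (X.d i j).hom (X.pOpcycles j).hom := by
  have h := ShortComplex.exact_of_g_is_cokernel
    (ShortComplex.mk (X.d i j) (X.pOpcycles j) (by simp))
    (X.opcyclesIsCokernel i j (c.prev_eq' hij))
  exact (ShortComplex.ShortExact.moduleCat_exact_iff_function_exact _).1 h

lemma d_hom_eq (i j : ι) : (X.d i j).hom = (X.fromOpcycles i j).hom ∘ₗ (X.pOpcycles i).hom := by
  rw [← ModuleCat.hom_comp, X.p_fromOpcycles]

lemma exact_fromOpcycles_pOpcycles {i j : ι} (hij : c.Rel i j) :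
    Function.Exact (X.fromOpcycles i j).hom (X.pOpcycles j).hom := by
  intro y
  rw [exact_d_pOpcycles X hij y, d_hom_eq, LinearMap.coe_comp,
    (pOpcycles_surjective X i).range_comp]

open MonoidalCategory

/-- Opcycles are the cokernel of the incoming differential and tensoring preserves cokernels, so the
homology at `j` is the kernel of the tensored map out of the opcycles. -/
lemma mapHomologicalComplex_tensorRight_exactAt_iff (N : ModuleCat.{u} R) {i j k : ι}
    (hij : c.Rel i j) (hjk : c.Rel j k) :
    (((tensorRight N).mapHomologicalComplex c).obj X).ExactAt j ↔
      Function.Injective ((X.fromOpcycles j k).hom.rTensor N) := by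
  rw [HomologicalComplex.exactAt_iff' _ i j k (c.prev_eq' hij) (c.next_eq' hjk),
    ShortComplex.ShortExact.moduleCat_exact_iff_function_exact,
    ← exact_rTensor_iff_injective N _ (exact_d_pOpcycles X hij) (pOpcycles_surjective X j),
    ← d_hom_eq]
  rfl

lemma mapHomologicalComplex_tensorLeft_exactAt_iff (N : ModuleCat.{u} R) {i j k : ι}
    (hij : c.Rel i j) (hjk : c.Rel j k) :
    (((tensorLeft N).mapHomologicalComplex c).obj X).ExactAt j ↔
      Function.Injective ((X.fromOpcycles j k).hom.lTensor N) := by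
  rw [HomologicalComplex.exactAt_iff' _ i j k (c.prev_eq' hij) (c.next_eq' hjk),
    ShortComplex.ShortExact.moduleCat_exact_iff_function_exact,
    ← exact_lTensor_iff_injective N _ (exact_d_pOpcycles X hij) (pOpcycles_surjective X j),
    ← d_hom_eq]
  rfl

lemma fromOpcycles_injective {j k : ι} (hjk : c.Rel j k) (h : X.ExactAt j) :
    Function.Injective (X.fromOpcycles j k).hom := by
  rw [HomologicalComplex.exactAt_iff' X _ j k rfl (c.next_eq' hjk),
    ShortComplex.ShortExact.moduleCat_exact_iff_function_exact] at h
  rw [injective_iff_map_eq_zero]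
  intro x hx
  obtain ⟨y, rfl⟩ := pOpcycles_surjective X j x
  rw [← LinearMap.comp_apply, ← d_hom_eq] at hx
  obtain ⟨z, rfl⟩ := (h y).1 hx
  exact congr($(X.d_pOpcycles (c.prev j) j) z)

/-- Balancing of `Tor` for two flat resolutions, given as complexes of arbitrary shapes which are
exact in the degrees `f 1, f 2, …` and `g 1, g 2, …`. -/
theorem tensorLeft_exactAt_iff_tensorRight_exactAt {ι' : Type*} {c' : ComplexShape ι'}
    (Y : HomologicalComplex (ModuleCat.{u} R) c') {f : ℕ → ι} {g : ℕ → ι'}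
    (hf : ∀ n, c.Rel (f (n + 1)) (f n)) (hg : ∀ n, c'.Rel (g (n + 1)) (g n))
    (hX : ∀ n, Module.Flat R (X.X (f n))) (hY : ∀ n, Module.Flat R (Y.X (g n)))
    (eX : ∀ n, X.ExactAt (f (n + 1))) (eY : ∀ n, Y.ExactAt (g (n + 1))) (n : ℕ) :
    (((tensorLeft (X.opcycles (f 0))).mapHomologicalComplex c').obj Y).ExactAt (g (n + 1)) ↔
      (((tensorRight (Y.opcycles (g 0))).mapHomologicalComplex c).obj X).ExactAt (f (n + 1)) := by
  rw [mapHomologicalComplex_tensorLeft_exactAt_iff Y _ (hg (n + 1)) (hg n),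
    mapHomologicalComplex_tensorRight_exactAt_iff X _ (hf (n + 1)) (hf n)]
  exact lTensor_injective_iff_rTensor_injective_of_syzygies
    (K := fun n ↦ X.opcycles (f n)) (P := fun n ↦ X.X (f n))
    (Z := fun n ↦ Y.opcycles (g n)) (Q := fun n ↦ Y.X (g n))
    (a := fun n ↦ (X.fromOpcycles (f (n + 1)) (f n)).hom) (b := fun n ↦ (X.pOpcycles (f n)).hom)
    (a' := fun n ↦ (Y.fromOpcycles (g (n + 1)) (g n)).hom) (b' := fun n ↦ (Y.pOpcycles (g n)).hom)
    (fun n ↦ fromOpcycles_injective X (hf n) (eX n))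
    (fun n ↦ exact_fromOpcycles_pOpcycles X (hf n)) (fun n ↦ pOpcycles_surjective X _)
    (fun n ↦ fromOpcycles_injective Y (hg n) (eY n))
    (fun n ↦ exact_fromOpcycles_pOpcycles Y (hg n)) (fun n ↦ pOpcycles_surjective Y _) n

end Complexes

/-! ### `Tor` from a resolution of the first argument -/

section Tor

open MonoidalCategory

variable {R : Type u} [CommRing R]

lemma mapHomologicalComplex_exactAt_iff_of_natIso {C D ι : Type*} [Category* C] [Category* D]
    [Preadditive C] [Preadditive D] [CategoryWithHomology D] {c : ComplexShape ι}
    {F G : C ⥤ D} [F.Additive] [G.Additive] (e : F ≅ G) (X : HomologicalComplex C c) (i : ι) :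
    ((F.mapHomologicalComplex c).obj X).ExactAt i ↔
      ((G.mapHomologicalComplex c).obj X).ExactAt i :=
  let e' := (NatIso.mapHomologicalComplex e c).app X
  ⟨fun h ↦ h.of_iso e', fun h ↦ h.of_iso e'.symm⟩

variable {M N : ModuleCat.{u} R} (P : ProjectiveResolution M) (Q : ProjectiveResolution N)

lemma projectiveResolution_opcycles_zero_iso : Nonempty (Q.complex.opcycles 0 ≅ N) :=
  ⟨Q.complex.isoHomologyι₀.symm ≪≫ isoOfQuasiIsoAt Q.π 0 ≪≫
    HomologicalComplex.singleObjHomologySelfIso _ _ _⟩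

lemma cochainComplex_opcycles_zero_iso : Nonempty (P.cochainComplex.opcycles 0 ≅ M) :=
  ⟨(P.cochainComplex.isoHomologyι 0 1 (by simp)
      ((CochainComplex.isZero_of_isStrictlyLE _ 0 1).eq_of_tgt _ _)).symm ≪≫
    isoOfQuasiIsoAt P.π' 0 ≪≫ HomologicalComplex.singleObjHomologySelfIso _ _ _⟩

lemma cochainComplex_exactAt {i : ℤ} (hi : i ≠ 0) : P.cochainComplex.ExactAt i := by
  rw [← quasiIsoAt_iff_exactAt' P.π' i (HomologicalComplex.exactAt_single_obj _ _ _ _ hi)]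
  infer_instance

lemma isZero_Tor_iff_tensorLeft_exactAt (i : ℕ) :
    Limits.IsZero (((Tor (ModuleCat.{u} R) i).obj M).obj N) ↔
      (((tensorLeft M).mapHomologicalComplex _).obj Q.complex).ExactAt i := by
  rw [HomologicalComplex.exactAt_iff_isZero_homology]
  exact (Q.isoLeftDerivedObj ((tensoringLeft _).obj M) i).isZero_iff

/-- Degree zero is right exactness of the tensor product; positive degrees are balancing, with `M`
and `N` recovered as the degree-zero opcycles of their resolutions. -/
theorem isZero_Tor_iff_exactAt (i : ℕ) :
    Limits.IsZero (((Tor (ModuleCat.{u} R) i).obj M).obj N) ↔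
      (((tensorRight N).mapHomologicalComplex _).obj P.cochainComplex).ExactAt (-(i : ℤ)) := by
  obtain ⟨eM⟩ := cochainComplex_opcycles_zero_iso P
  cases i with
  | zero =>
    have e : ((Tor (ModuleCat.{u} R) 0).obj M).obj N ≅ P.cochainComplex.opcycles 0 ⊗ N :=
      ((tensoringLeft _).obj M).leftDerivedZeroIsoSelf.app N ≪≫ whiskerRightIso eM.symm N
    have hs : Subsingleton (P.cochainComplex.X 1) :=
      ModuleCat.subsingleton_of_isZero (CochainComplex.isZero_of_isStrictlyLE _ 0 1)
    rw [e.isZero_iff, ModuleCat.isZero_iff_subsingleton]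
    simp only [Nat.cast_zero, neg_zero]
    rw [mapHomologicalComplex_tensorRight_exactAt_iff P.cochainComplex N
      (i := -1) (j := 0) (k := 1) (by simp) (by simp)]
    -- The target of the map is zero, so injectivity means that its source `opcycles 0 ⊗ N` is zero.
    have : Subsingleton (TensorProduct R (P.cochainComplex.X 1) N) := inferInstance
    exact ⟨fun h ↦ @Function.injective_of_subsingleton _ _ h _, fun h ↦ h.subsingleton⟩
  | succ n =>
    let Q : ProjectiveResolution N := projectiveResolution N
    obtain ⟨eN⟩ := projectiveResolution_opcycles_zero_iso Q
    rw [isZero_Tor_iff_tensorLeft_exactAt Q]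
    have h := tensorLeft_exactAt_iff_tensorRight_exactAt P.cochainComplex Q.complex
      (f := fun n ↦ -(n : ℤ)) (g := fun n ↦ n) (fun n ↦ by simp) (fun n ↦ by simp)
      (fun n ↦ inferInstance) (fun n ↦ inferInstance)
      (fun n ↦ cochainComplex_exactAt P (by omega)) (fun n ↦ Q.complex_exactAt_succ n) n
    exact (mapHomologicalComplex_exactAt_iff_of_natIso
        ((tensoringLeft _).mapIso eM) _ _).symm.trans
      (h.trans (mapHomologicalComplex_exactAt_iff_of_natIso
        ((tensoringRight _).mapIso eN) _ _))

end Tor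

/-! ### Depth and the lowest cohomology module -/

section DepthLemmas

attribute [local instance] HasDerivedCategory.standard

open DerivedCategory

variable {R : Type u} [CommRing R]

/-- In the standard t-structure `A` lies in degrees at most `0` and `X[i]` in degrees at least `n -
i > 0`. -/
lemma hyperExt_subsingleton_of_isGE (A : ModuleCat.{u} R) (X : CochainComplex (ModuleCat.{u} R) ℤ)
    {i n : ℤ} (hX : X.IsGE n) (hi : i < n) : Subsingleton (HyperExt R A X i) := by
  have h1 : ((shiftFunctor (DerivedCategory (ModuleCat.{u} R)) i).obj (Q.obj X)).IsGE (n - i) :=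
    TStructure.t.isGE_shift _ n i (n - i) (by omega)
  refine ⟨fun f g ↦ ?_⟩
  have h2 (f : HyperExt R A X i) : f = 0 := by
    exact TStructure.t.zero
      (X := Q.obj ((CochainComplex.singleFunctor (ModuleCat.{u} R) 0).obj A)) f 0 (n - i) (by omega)
  rw [h2 f, h2 g]

lemma hyperExt_congr (A : ModuleCat.{u} R) {X Y : CochainComplex (ModuleCat.{u} R) ℤ}
    (f : X ⟶ Y) [QuasiIso f] (i : ℤ) : Nonempty (HyperExt R A X i ≃ HyperExt R A Y i) :=
  ⟨((shiftFunctor (DerivedCategory (ModuleCat.{u} R)) i).mapIso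
    (asIso (Q.map f))).homToEquiv⟩

/-- With nothing below degree `n`, cohomology there is a submodule of `X.X n`, so `φ` is realized by
an honest chain map, which `homologyMap` shows to be nonzero in the derived category. -/
lemma hyperExt_nontrivial_of_isStrictlyGE (A : ModuleCat.{u} R)
    (X : CochainComplex (ModuleCat.{u} R) ℤ) {n : ℤ} [X.IsStrictlyGE n] (φ : A ⟶ X.homology n)
    (hφ : φ ≠ 0) : Nontrivial (HyperExt R A X n) := by
  have : IsIso (X.homologyπ n) := X.isIso_homologyπ (n - 1) n (by simp)
    ((CochainComplex.isZero_of_isStrictlyGE X n (n - 1)).eq_of_src _ _)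
  let ψ : A ⟶ X.X n := φ ≫ inv (X.homologyπ n) ≫ X.iCycles n
  have hψ : ψ ≠ 0 := by
    intro h
    apply hφ
    rw [← cancel_mono (inv (X.homologyπ n) ≫ X.iCycles n), Limits.zero_comp]
    exact h
  let f : (CochainComplex.singleFunctor (ModuleCat.{u} R) n).obj A ⟶ X :=
    HomologicalComplex.mkHomFromSingle ψ (by simp [ψ])
  have hf : f.f n = (HomologicalComplex.singleObjXSelf _ n A).hom ≫ ψ :=
    HomologicalComplex.mkHomFromSingle_f _ _
  let e := ((singleFunctors (ModuleCat.{u} R)).shiftIso n 0 n (by simp)).app A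
  let g : HyperExt R A X n :=
    e.inv ≫ (shiftFunctor (DerivedCategory (ModuleCat.{u} R)) n).map (Q.map f)
  suffices hg : g ≠ 0 from ⟨g, 0, hg⟩
  intro hg
  have h1 : Q.map f = 0 := by
    apply (shiftFunctor (DerivedCategory (ModuleCat.{u} R)) n).map_injective
    rw [Functor.map_zero]
    exact (cancel_epi e.inv).1 (hg.trans Limits.comp_zero.symm)
  have h2 : HomologicalComplex.homologyMap f n = 0 := by
    have := NatIso.naturality_1 (homologyFunctorFactors (ModuleCat.{u} R) n) f
    rw [Functor.comp_map, h1, Functor.map_zero, Limits.zero_comp, Limits.comp_zero] at this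
    exact this.symm
  -- On cycles of `X` in degree `n` nothing is divided out, and in the source every element is a
  -- cycle; so a zero map on homology forces `f.f n = 0`.
  apply hψ
  have h3 : HomologicalComplex.cyclesMap f n = 0 := by
    rw [← cancel_mono (X.homologyπ n), ← HomologicalComplex.homologyπ_naturality, h2,
      Limits.comp_zero, Limits.zero_comp]
  have h4 := HomologicalComplex.cyclesMap_i f n
  rw [h3, Limits.zero_comp, hf] at h4
  have : IsIso (((CochainComplex.singleFunctor (ModuleCat.{u} R) n).obj A).iCycles n) :=
    HomologicalComplex.isIso_iCycles _ n (n + 1) (by simp)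
      (HomologicalComplex.single_obj_d _ _ _ _ _)
  have h5 := (cancel_epi (((CochainComplex.singleFunctor (ModuleCat.{u} R) n).obj A).iCycles n)).1
    (h4.symm.trans Limits.comp_zero.symm)
  exact (cancel_epi (HomologicalComplex.singleObjXSelf (ComplexShape.up ℤ) n A).hom).1
    (h5.trans Limits.comp_zero.symm)

/-- Truncation replaces `X` by a quasi-isomorphic complex that is zero below `n`. -/
lemma hyperExt_nontrivial (A : ModuleCat.{u} R) (X : CochainComplex (ModuleCat.{u} R) ℤ)
    {n : ℤ} (hX : X.IsGE n) (φ : A ⟶ X.homology n) (hφ : φ ≠ 0) :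
    Nontrivial (HyperExt R A X n) := by
  obtain ⟨e⟩ := hyperExt_congr A (X.πTruncGE n) n
  have := hyperExt_nontrivial_of_isStrictlyGE A (X.truncGE n)
    (φ ≫ HomologicalComplex.homologyMap (X.πTruncGE n) n) (by
      intro h
      exact hφ (by rwa [← cancel_mono (HomologicalComplex.homologyMap (X.πTruncGE n) n),
        Limits.zero_comp]))
  exact e.nontrivial

lemma le_complexDepth_of_isGE [IsLocalRing R] (X : CochainComplex (ModuleCat.{u} R) ℤ)
    {n : ℤ} (hX : X.IsGE n) : ((n : ℝ) : EReal) ≤ complexDepth R X := by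
  refine le_iInf₂ fun i hi ↦ ?_
  rw [EReal.coe_le_coe_iff, Int.cast_le]
  by_contra! h
  have := hyperExt_subsingleton_of_isGE (ModuleCat.of R (IsLocalRing.ResidueField R)) X hX h
  exact not_subsingleton _ this

lemma exists_residueField_linearMap_ne_zero [IsLocalRing R] {M : Type*} [AddCommGroup M]
    [Module R M] {x : M} (hx : x ≠ 0) (h : ∀ r ∈ IsLocalRing.maximalIdeal R, r • x = 0) :
    ∃ φ : IsLocalRing.ResidueField R →ₗ[R] M, φ ≠ 0 := by
  let φ : (R ⧸ IsLocalRing.maximalIdeal R) →ₗ[R] M :=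
    (IsLocalRing.maximalIdeal R).liftQ (LinearMap.toSpanSingleton R M x)
      fun r hr ↦ by simpa using h r hr
  refine ⟨φ, fun H ↦ hx ?_⟩
  have h1 : φ (Submodule.Quotient.mk 1) = 0 := congr($H _)
  simpa only [φ, Submodule.liftQ_apply, LinearMap.toSpanSingleton_apply, one_smul] using h1

lemma complexDepth_le [IsLocalRing R] (X : CochainComplex (ModuleCat.{u} R) ℤ)
    {n : ℤ} (hX : X.IsGE n) (x : X.homology n) (hx : x ≠ 0)
    (h : ∀ r ∈ IsLocalRing.maximalIdeal R, r • x = 0) : complexDepth R X ≤ ((n : ℝ) : EReal) := by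
  obtain ⟨φ, hφ⟩ := exists_residueField_linearMap_ne_zero hx h
  refine iInf₂_le n (hyperExt_nontrivial _ X hX (ModuleCat.ofHom φ) fun H ↦ hφ ?_)
  exact congr(($H).hom)

lemma moduleDepth_nonneg [IsLocalRing R] (M : Type u) [AddCommGroup M] [Module R M] :
    0 ≤ moduleDepth R M := by
  simpa [moduleDepth] using le_complexDepth_of_isGE (n := 0) (moduleComplex R M) inferInstance

lemma complexDepth_eq_top_of_exact [IsLocalRing R] (X : CochainComplex (ModuleCat.{u} R) ℤ)
    (hX : ∀ i, X.ExactAt i) : complexDepth R X = ⊤ := by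
  rw [EReal.eq_top_iff_forall_lt]
  intro y
  obtain ⟨n, hn⟩ := exists_int_gt y
  refine lt_of_lt_of_le (EReal.coe_lt_coe_iff.2 hn) (le_complexDepth_of_isGE X ?_)
  rw [CochainComplex.isGE_iff]
  exact fun i _ ↦ hX i

lemma nontrivial_of_moduleDepth_ne_top [IsLocalRing R] {M : Type u} [AddCommGroup M] [Module R M]
    (h : moduleDepth R M ≠ ⊤) : Nontrivial M := by
  by_contra! hM
  refine h (complexDepth_eq_top_of_exact _ fun i ↦ ?_)
  rw [HomologicalComplex.exactAt_iff_isZero_homology]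
  by_cases hi : i = 0
  · subst hi
    exact (ModuleCat.isZero_of_subsingleton (ModuleCat.of R M)).of_iso
      (HomologicalComplex.singleObjHomologySelfIso _ _ _)
  · rw [← HomologicalComplex.exactAt_iff_isZero_homology]
    exact HomologicalComplex.exactAt_single_obj _ _ _ _ hi

/-- Passage from `HyperExt` to `Abelian.Ext`, in which the criterion for regular sequences is
stated. -/
lemma subsingleton_ext_of_moduleDepth_eq_top [IsLocalRing R] {M : Type u} [AddCommGroup M]
    [Module R M] (h : moduleDepth R M = ⊤) (i : ℕ) :
    Subsingleton (Abelian.Ext (ModuleCat.of R (IsLocalRing.ResidueField R))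
      (ModuleCat.of R M) i) := by
  have h1 : ¬ Nontrivial (HyperExt R (ModuleCat.of R (IsLocalRing.ResidueField R))
      (moduleComplex R M) i) := by
    intro hi
    have : moduleDepth R M ≤ (((i : ℤ) : ℝ) : EReal) := iInf₂_le (i : ℤ) hi
    rw [h, top_le_iff] at this
    exact EReal.coe_ne_top _ this
  rw [not_nontrivial_iff_subsingleton] at h1
  exact (Localization.SmallShiftedHom.equiv
    (HomologicalComplex.quasiIso (ModuleCat.{u} R) (ComplexShape.up ℤ)) Q).subsingleton_congr.2 h1

lemma length_le_of_isRegular_self [IsLocalRing R] [IsNoetherianRing R] {rs : List R}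
    (hrs : RingTheory.Sequence.IsRegular R rs) {n : ℕ} (hn : ringKrullDim R = n) :
    rs.length ≤ n := by
  have h1 := ringKrullDim_add_length_eq_ringKrullDim_of_isRegular rs hrs
  have : Nontrivial (R ⧸ Ideal.ofList rs) := by
    refine Ideal.Quotient.nontrivial_iff.2 fun H ↦ hrs.top_ne_smul ?_
    rw [H, Submodule.top_smul]
  have h2 := ringKrullDim_nonneg_of_nontrivial (R := R ⧸ Ideal.ofList rs)
  rw [hn] at h1
  have h3 : ((rs.length : ℕ) : WithBot ℕ∞) ≤ n := (le_add_of_nonneg_left h2).trans h1.le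
  exact_mod_cast h3

lemma exists_ringKrullDim_eq_natCast (A : Type*) [CommRing A] [FiniteRingKrullDim A] :
    ∃ n : ℕ, ringKrullDim A = n :=
  ⟨_, Order.krullDim_eq_length_of_finiteDimensionalOrder⟩

lemma finite_residueField [IsLocalRing R] : Module.Finite R (IsLocalRing.ResidueField R) :=
  .of_surjective (Algebra.linearMap R _) IsLocalRing.residue_surjective

lemma support_residueField [IsLocalRing R] : Module.support R (IsLocalRing.ResidueField R) =
      PrimeSpectrum.zeroLocus (IsLocalRing.maximalIdeal R) := by
  have := finite_residueField (R := R)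
  rw [Module.support_eq_zeroLocus]
  congr 2
  ext r
  rw [Module.mem_annihilator, ← IsLocalRing.residue_eq_zero_iff]
  refine ⟨fun h ↦ ?_, fun h x ↦ ?_⟩
  · simpa [Algebra.smul_def] using h 1
  · rw [Algebra.smul_def, IsLocalRing.ResidueField.algebraMap_eq, h, zero_mul]

/-- Infinite depth would yield a regular sequence of length `dim R + 1`, but each term of a regular
sequence lowers the dimension by one. -/
lemma moduleDepth_self_ne_top [IsLocalRing R] [IsNoetherianRing R] : moduleDepth R R ≠ ⊤ := by
  intro h
  obtain ⟨n, hn⟩ := exists_ringKrullDim_eq_natCast R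
  have hm : IsLocalRing.maximalIdeal R • (⊤ : Submodule R R) < ⊤ := by
    rw [smul_eq_mul, Ideal.mul_top]
    exact lt_top_iff_ne_top.2 Ideal.IsPrime.ne_top'
  have : Module.Finite R (ModuleCat.of R (IsLocalRing.ResidueField R)) := finite_residueField
  obtain ⟨rs, hrs, -, hreg⟩ := ModuleCat.exists_isRegular_of_exists_subsingleton_ext
    (IsLocalRing.maximalIdeal R) (n + 1) (ModuleCat.of R R) hm
    (ModuleCat.of R (IsLocalRing.ResidueField R))
    support_residueField (fun i _ ↦ subsingleton_ext_of_moduleDepth_eq_top h i)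
  have : rs.length ≤ n := length_le_of_isRegular_self hreg hn
  omega

end DepthLemmas

/-! ### Total tensor product with a module in degree zero -/

section TensorSingle

open MonoidalCategory HomologicalComplex

variable {R : Type u} [CommRing R]

/-- The inclusion of `K ⊗ Y` in degree `i` into the total tensor product of `K` with `Y`
concentrated in degree `0`. -/
noncomputable def tensorSingleι (K : CochainComplex (ModuleCat.{u} R) ℤ) (Y : ModuleCat.{u} R)
    (i : ℤ) : K.X i ⊗ Y ⟶
      (HomologicalComplex.tensorObj K ((single _ (ComplexShape.up ℤ) 0).obj Y)).X i :=
  K.X i ◁ (singleObjXSelf (ComplexShape.up ℤ) 0 Y).inv ≫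
    ιTensorObj K ((single _ (ComplexShape.up ℤ) 0).obj Y) i 0 i (add_zero i)

/-- The projection of the total tensor product of `K` with `Y` concentrated in degree `0`,
inverse to `tensorSingleι`. -/
noncomputable def tensorSingleDesc (K : CochainComplex (ModuleCat.{u} R) ℤ) (Y : ModuleCat.{u} R)
    (i : ℤ) : (HomologicalComplex.tensorObj K ((single _ (ComplexShape.up ℤ) 0).obj Y)).X i ⟶
      K.X i ⊗ Y :=
  mapBifunctorDesc fun i₁ i₂ h ↦
    if h₂ : i₂ = 0 then
      (K.XIsoOfEq (by subst h₂; simpa using h)).hom ⊗ₘ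
        (singleObjXIsoOfEq (ComplexShape.up ℤ) 0 Y i₂ h₂).hom
    else 0

lemma tensorSingleι_desc (K : CochainComplex (ModuleCat.{u} R) ℤ) (Y : ModuleCat.{u} R)
    (i : ℤ) : tensorSingleι K Y i ≫ tensorSingleDesc K Y i = 𝟙 _ := by
  simp only [tensorSingleι, tensorSingleDesc, Category.assoc, ι_mapBifunctorDesc]
  change _ ≫ (𝟙 (K.X i) ⊗ₘ (singleObjXSelf (ComplexShape.up ℤ) 0 Y).hom) = _
  rw [id_tensorHom, ← whiskerLeft_comp, Iso.inv_hom_id, whiskerLeft_id]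

lemma tensorSingleDesc_ι (K : CochainComplex (ModuleCat.{u} R) ℤ) (Y : ModuleCat.{u} R)
    (i : ℤ) : tensorSingleDesc K Y i ≫ tensorSingleι K Y i = 𝟙 _ := by
  apply mapBifunctor.hom_ext
  intro i₁ i₂ h
  simp only [tensorSingleι, tensorSingleDesc, ι_mapBifunctorDesc_assoc]
  by_cases h₂ : i₂ = 0
  · subst h₂
    obtain rfl : i₁ = i := by simpa using h
    rw [dif_pos rfl]
    change (𝟙 (K.X i₁) ⊗ₘ (singleObjXSelf (ComplexShape.up ℤ) 0 Y).hom) ≫ _ ≫ _ = _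
    rw [id_tensorHom, ← whiskerLeft_comp_assoc, Iso.hom_inv_id, whiskerLeft_id, Category.id_comp,
      Category.comp_id]
  · have : Limits.IsZero (((single (ModuleCat.{u} R) (ComplexShape.up ℤ) 0).obj Y).X i₂) :=
      isZero_single_obj_X _ _ _ _ h₂
    exact ((tensorLeft (K.X i₁)).map_isZero this).eq_of_src _ _

lemma tensorSingleι_comm (K : CochainComplex (ModuleCat.{u} R) ℤ) (Y : ModuleCat.{u} R)
    (i j : ℤ) (hij : (ComplexShape.up ℤ).Rel i j) :
    tensorSingleι K Y i ≫ (HomologicalComplex.tensorObj K ((single _ (ComplexShape.up ℤ) 0).obj Y)).d i j =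
      K.d i j ▷ Y ≫ tensorSingleι K Y j := by
  simp only [tensorSingleι, Category.assoc, mapBifunctor.d_eq, Preadditive.comp_add,
    mapBifunctor.ι_D₁, mapBifunctor.ι_D₂]
  rw [mapBifunctor.d₁_eq _ _ _ _ hij _ _ (by simp)]
  -- The second factor has zero differential, so only the differential of `K` remains, with sign `ε₁
  -- = 1`.
  have h₂ : mapBifunctor.d₂ K ((single (ModuleCat.{u} R) (ComplexShape.up ℤ) 0).obj Y)
      (curriedTensor (ModuleCat.{u} R)) (ComplexShape.up ℤ) i 0 j = 0 := by
    by_cases h : ComplexShape.π (ComplexShape.up ℤ) (ComplexShape.up ℤ) (ComplexShape.up ℤ)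
        (i, 1) = j
    · rw [mapBifunctor.d₂_eq _ _ _ _ _ (i₂' := 1) (by simp) _ h, single_obj_d, Functor.map_zero,
        Limits.zero_comp, smul_zero]
    · rw [mapBifunctor.d₂_eq_zero' _ _ _ _ _ (i₂' := 1) (by simp) _ h]
  rw [h₂, Limits.comp_zero, add_zero]
  simp [ComplexShape.ε₁_def, whisker_exchange_assoc]

/-- The total tensor product of `K` with `Y` concentrated in degree `0` is the termwise tensor
product of `K` with `Y`. -/
noncomputable def tensorSingleIso (K : CochainComplex (ModuleCat.{u} R) ℤ) (Y : ModuleCat.{u} R) :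
    ((tensorRight Y).mapHomologicalComplex _).obj K ≅
      HomologicalComplex.tensorObj K ((single _ (ComplexShape.up ℤ) 0).obj Y) :=
  Hom.isoOfComponents (fun i ↦ ⟨tensorSingleι K Y i, tensorSingleDesc K Y i,
    tensorSingleι_desc K Y i, tensorSingleDesc_ι K Y i⟩)
    (fun i j hij ↦ tensorSingleι_comm K Y i j hij)

end TensorSingle

/-! ### Localization and tensor products -/

section LocalizedTensor

open MonoidalCategory

variable {R : Type u} [CommRing R]

/-- Each element of `X'` has a multiple by some `s ∈ S` in the image of `f`, and `s` acts invertibly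
on `Y`. -/
lemma linearMap_ext_of_isLocalizedModule (S : Submonoid R) {A : Type*} [CommRing A] [Algebra R A]
    [IsLocalization S A] {X X' Y : Type*} [AddCommGroup X] [Module R X] [AddCommGroup X']
    [Module R X'] [Module A X'] [IsScalarTower R A X'] [AddCommGroup Y] [Module A Y]
    (f : X →ₗ[R] X') [IsLocalizedModule S f] {g g' : X' →ₗ[A] Y}
    (h : ∀ x, g (f x) = g' (f x)) : g = g' := by
  ext z
  obtain ⟨⟨x, s⟩, hx⟩ := IsLocalizedModule.surj S f z
  rw [← (IsLocalization.map_units A s).smul_left_cancel, ← map_smul, ← map_smul,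
    algebraMap_smul]
  have : (s : R) • z = f x := hx
  rw [this, h]

/-- If `M'`, `N'`, `T'` are localizations of `M`, `N`, `M ⊗ N`, then `T' ≃ M' ⊗ N'`. -/
noncomputable def localizedTensorEquiv (S : Submonoid R) (A : Type*) [CommRing A] [Algebra R A]
    [IsLocalization S A] {M M' N N' T' : Type*} [AddCommGroup M] [Module R M] [AddCommGroup M']
    [Module R M'] [Module A M'] [IsScalarTower R A M'] [AddCommGroup N] [Module R N]
    [AddCommGroup N'] [Module R N'] [Module A N'] [IsScalarTower R A N'] [AddCommGroup T']
    [Module R T'] [Module A T'] [IsScalarTower R A T']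
    (f : M →ₗ[R] M') (g : N →ₗ[R] N') (h : TensorProduct R M N →ₗ[R] T')
    [IsLocalizedModule S f] [IsLocalizedModule S g] [IsLocalizedModule S h] :
    T' ≃ₗ[A] TensorProduct A M' N' :=
  (IsLocalizedModule.linearEquiv S h (TensorProduct.map f g)).extendScalarsOfIsLocalization S A ≪≫ₗ
    (IsLocalization.moduleTensorEquiv S A M' N').symm

lemma localizedTensorEquiv_apply_tmul (S : Submonoid R) (A : Type*) [CommRing A] [Algebra R A]
    [IsLocalization S A] {M M' N N' T' : Type*} [AddCommGroup M] [Module R M] [AddCommGroup M']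
    [Module R M'] [Module A M'] [IsScalarTower R A M'] [AddCommGroup N] [Module R N]
    [AddCommGroup N'] [Module R N'] [Module A N'] [IsScalarTower R A N'] [AddCommGroup T']
    [Module R T'] [Module A T'] [IsScalarTower R A T']
    (f : M →ₗ[R] M') (g : N →ₗ[R] N') (h : TensorProduct R M N →ₗ[R] T')
    [IsLocalizedModule S f] [IsLocalizedModule S g] [IsLocalizedModule S h] (m : M) (n : N) :
    localizedTensorEquiv S A f g h (h (TensorProduct.tmul R m n)) =
      TensorProduct.tmul A (f m) (g n) := by
  have e : IsLocalizedModule.linearEquiv S h (TensorProduct.map f g)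
      (h (TensorProduct.tmul R m n)) = TensorProduct.tmul R (f m) (g n) := by
    rw [IsLocalizedModule.linearEquiv_apply, TensorProduct.map_tmul]
  refine (congrArg (IsLocalization.moduleTensorEquiv S A M' N').symm e).trans ?_
  rw [LinearEquiv.symm_apply_eq]
  rfl

variable (S : Submonoid R)

lemma localizedModuleMap_mk {M M' : ModuleCat.{u} R} (f : M ⟶ M') (m : M) :
    (ModuleCat.localizedModuleMap S f).hom (M.localizedModuleMkLinearMap S m) =
      M'.localizedModuleMkLinearMap S (f.hom m) :=
  IsLocalizedModule.map_apply S (M.localizedModuleMkLinearMap S)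
    (M'.localizedModuleMkLinearMap S) f.hom m

/-- The localization map of `M ⊗ N`, as a linear map from the tensor product. -/
noncomputable def localizedTensorMk (M N : ModuleCat.{u} R) :
    TensorProduct R M N →ₗ[R] (M ⊗ N : ModuleCat.{u} R).localizedModule S :=
  (M ⊗ N : ModuleCat.{u} R).localizedModuleMkLinearMap S

instance (M N : ModuleCat.{u} R) : IsLocalizedModule S (localizedTensorMk S M N) :=
  ModuleCat.localizedModule_isLocalizedModule (M ⊗ N : ModuleCat.{u} R) S

/-- The canonical isomorphism `(M ⊗ N)_S ≃ M_S ⊗ N_S`. -/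
noncomputable def localizedModuleTensorEquiv (M N : ModuleCat.{u} R) :
    (M ⊗ N : ModuleCat.{u} R).localizedModule S ≃ₗ[Localization S]
      TensorProduct (Localization S) (M.localizedModule S) (N.localizedModule S) :=
  localizedTensorEquiv S (Localization S) (M.localizedModuleMkLinearMap S)
    (N.localizedModuleMkLinearMap S) (localizedTensorMk S M N)

lemma localizedModuleTensorEquiv_naturality {M M' : ModuleCat.{u} R} (f : M ⟶ M')
    (N : ModuleCat.{u} R) :
    (localizedModuleTensorEquiv S M' N).toLinearMap ∘ₗ
        (ModuleCat.localizedModuleMap S (f ▷ N)).hom =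
      (ModuleCat.localizedModuleMap S f).hom.rTensor (N.localizedModule S) ∘ₗ
        (localizedModuleTensorEquiv S M N).toLinearMap := by
  refine linearMap_ext_of_isLocalizedModule S (A := Localization S)
      (localizedTensorMk S M N) fun x ↦ ?_
  induction x using TensorProduct.induction_on with
  | zero => rw [map_zero, map_zero, map_zero]
  | add x y hx hy => rw [map_add, map_add, map_add, hx, hy]
  | tmul m n =>
    rw [LinearMap.comp_apply, LinearMap.comp_apply, LinearEquiv.coe_coe, LinearEquiv.coe_coe]
    have h : localizedModuleTensorEquiv S M N (localizedTensorMk S M N (TensorProduct.tmul R m n)) =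
        _ := localizedTensorEquiv_apply_tmul S (Localization S) _ _ _ m n
    rw [h, LinearMap.rTensor_tmul, localizedModuleMap_mk]
    refine (congrArg (localizedModuleTensorEquiv S _ _) (localizedModuleMap_mk S (f ▷ N)
      (TensorProduct.tmul R m n))).trans ?_
    exact localizedTensorEquiv_apply_tmul S (Localization S) _ _ _ (f.hom m) n

/-- Localization commutes with `- ⊗ N`. -/
noncomputable def localizedModuleFunctorTensorRightIso (N : ModuleCat.{u} R) :
    tensorRight N ⋙ ModuleCat.localizedModuleFunctor.{u} S ≅
      ModuleCat.localizedModuleFunctor.{u} S ⋙ tensorRight (N.localizedModule S) :=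
  NatIso.ofComponents (fun M ↦ (localizedModuleTensorEquiv S M N).toModuleIso)
    fun f ↦ ModuleCat.hom_ext (localizedModuleTensorEquiv_naturality S f N)

end LocalizedTensor

/-! ### Localized resolutions and derived tensor products -/

section LocalizedResolution

open MonoidalCategory

variable {R : Type u} [CommRing R]

/-- `LocalizedModule S M` as the value at `M` of the localization functor. -/
noncomputable def localizedModuleIso (S : Submonoid R) (M : Type u) [AddCommGroup M] [Module R M] :
    (ModuleCat.of R M).localizedModule S ≅ ModuleCat.of (Localization S) (LocalizedModule S M) :=
  (Shrink.linearEquiv (Localization S) (LocalizedModule S M)).toModuleIso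

/-- Localization commutes with the formation of complexes concentrated in degree `0`. -/
noncomputable def localizedModuleComplexIso (p : PrimeSpectrum R) (M : Type u) [AddCommGroup M]
    [Module R M] :
    ((ModuleCat.localizedModuleFunctor.{u} p.asIdeal.primeCompl).mapHomologicalComplex
      (ComplexShape.up ℤ)).obj ((CochainComplex.singleFunctor _ 0).obj (ModuleCat.of R M)) ≅
      localizedComplex R M p :=
  (HomologicalComplex.singleMapHomologicalComplex
    (ModuleCat.localizedModuleFunctor.{u} p.asIdeal.primeCompl) _ 0).app (ModuleCat.of R M) ≪≫
  (HomologicalComplex.single _ (ComplexShape.up ℤ) 0).mapIso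
    (localizedModuleIso p.asIdeal.primeCompl M)

/-- The localization at `p` of a projective resolution of `M`. -/
noncomputable def localizedResolution {M : Type u} [AddCommGroup M] [Module R M]
    (P : ProjectiveResolution (ModuleCat.of R M)) (p : PrimeSpectrum R) :
    ComplexProjectiveResolution (localizedComplex R M p) where
  complex := ((ModuleCat.localizedModuleFunctor.{u} p.asIdeal.primeCompl).mapHomologicalComplex
    (ComplexShape.up ℤ)).obj P.cochainComplex
  π := ((ModuleCat.localizedModuleFunctor.{u} p.asIdeal.primeCompl).mapHomologicalComplex
      (ComplexShape.up ℤ)).map P.π' ≫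
    (localizedModuleComplexIso p M).hom
  projective i := (ModuleCat.localizedModuleFunctor.{u} p.asIdeal.primeCompl).projective_obj _
  bounded := ⟨0, fun i hi ↦ (ModuleCat.localizedModuleFunctor.{u} p.asIdeal.primeCompl).map_isZero
    (CochainComplex.isZero_of_isStrictlyLE _ 0 i hi)⟩
  quasiIso := by
    have h₁ : QuasiIso (((ModuleCat.localizedModuleFunctor.{u}
      p.asIdeal.primeCompl).mapHomologicalComplex (ComplexShape.up ℤ)).map P.π') := inferInstance
    have h₂ : QuasiIso (localizedModuleComplexIso p M).hom := inferInstance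
    exact quasiIso_comp _ _

/-- The derived tensor product of `M_p` and `N_p` is the localization of that of `M` and `N`. -/
noncomputable def localizedDerivedTensorIso {M N : Type u} [AddCommGroup M] [Module R M]
    [AddCommGroup N] [Module R N] (P : ProjectiveResolution (ModuleCat.of R M))
    (p : PrimeSpectrum R) :
    (localizedResolution P p).derivedTensor (localizedComplex R N p) ≅
      ((ModuleCat.localizedModuleFunctor.{u} p.asIdeal.primeCompl).mapHomologicalComplex
        (ComplexShape.up ℤ)).obj
        (((tensorRight (ModuleCat.of R N)).mapHomologicalComplex _).obj P.cochainComplex) :=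
  (tensorSingleIso (localizedResolution P p).complex _).symm ≪≫
    (NatIso.mapHomologicalComplex ((tensoringRight _).mapIso
      (localizedModuleIso p.asIdeal.primeCompl N)) _).symm.app _ ≪≫
    (NatIso.mapHomologicalComplex (localizedModuleFunctorTensorRightIso p.asIdeal.primeCompl
      (ModuleCat.of R N)) (ComplexShape.up ℤ)).symm.app P.cochainComplex

end LocalizedResolution

/-! ### Localized homology and associated primes -/

section LocalizedHomology

variable {R : Type u} [CommRing R] (S : Submonoid R)

/-- Localization commutes with homology. -/
noncomputable def localizedHomologyIso (T : CochainComplex (ModuleCat.{u} R) ℤ) (i : ℤ) :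
    (((ModuleCat.localizedModuleFunctor.{u} S).mapHomologicalComplex _).obj T).homology i ≅
      (T.homology i).localizedModule S :=
  (T.sc i).mapHomologyIso (ModuleCat.localizedModuleFunctor.{u} S)

/-- Take `p = ann x` an associated prime: nothing outside `p` kills `x`, so `x` survives in `H_p`,
where `p R_p` kills it. -/
lemma exists_killed_by_maximalIdeal [IsNoetherianRing R] (H : ModuleCat.{u} R) [Nontrivial H] :
    ∃ (p : PrimeSpectrum R) (y : H.localizedModule p.asIdeal.primeCompl), y ≠ 0 ∧
      ∀ r ∈ IsLocalRing.maximalIdeal (Localization.AtPrime p.asIdeal), r • y = 0 := by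
  obtain ⟨I, hI⟩ := associatedPrimes.nonempty R H
  obtain ⟨hp, x, hx⟩ := isAssociatedPrime_iff.1 hI
  have hx (a : R) : a ∈ I ↔ a • x = 0 := by
    rw [hx, Submodule.mem_colon_singleton, Submodule.mem_bot]
  refine ⟨⟨I, hp⟩, H.localizedModuleMkLinearMap I.primeCompl x, fun h ↦ ?_, fun r hr ↦ ?_⟩
  · obtain ⟨s, hs⟩ := (IsLocalizedModule.eq_zero_iff I.primeCompl
      (H.localizedModuleMkLinearMap I.primeCompl)).1 h
    exact s.2 ((hx s).2 hs)
  · obtain ⟨a, s, rfl⟩ := IsLocalization.exists_mk'_eq I.primeCompl r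
    have ha : a ∈ I := (IsLocalization.AtPrime.mk'_mem_maximal_iff _ I a s).1 hr
    rw [← (IsLocalization.map_units (Localization I.primeCompl) s).smul_left_cancel, smul_smul,
      mul_comm, IsLocalization.mk'_spec, smul_zero, algebraMap_smul, ← map_smul, (hx a).1 ha,
      map_zero]

lemma hasFGTerms_moduleComplex (M : Type u) [AddCommGroup M] [Module R M] [Module.Finite R M] :
    HasFGTerms (moduleComplex R M) := by
  intro i
  by_cases hi : i = 0
  · exact Module.Finite.equiv (HomologicalComplex.singleObjXIsoOfEq (ComplexShape.up ℤ) 0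
      (ModuleCat.of R M) i hi).symm.toLinearEquiv
  · have := ModuleCat.subsingleton_of_isZero (HomologicalComplex.isZero_single_obj_X
      (ComplexShape.up ℤ) 0 (ModuleCat.of R M) i hi)
    exact @Module.Finite.of_finite _ _ _ _ _ (@Finite.of_subsingleton _ this)

lemma hasBoundedHomology_moduleComplex (M : Type u) [AddCommGroup M] [Module R M] :
    HasBoundedHomology (moduleComplex R M) :=
  ⟨0, 0, fun _ hi ↦ HomologicalComplex.exactAt_single_obj _ _ _ _ (by omega)⟩

end LocalizedHomology

/-! ### Extended-real arithmetic of depths -/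

section ERealLemmas

/-- Finiteness of `r` bounds `m + n`, and since neither summand is `⊥`, both are real. -/
lemma ereal_le_sub_sub_of_add_le {q : ℝ} {r m n : EReal} (hr : r ≠ ⊤) (hr' : 0 ≤ r) (hm : 0 ≤ m)
    (hn : 0 ≤ n) (h : m + n ≤ ((-q : ℝ) : EReal) + r) :
    m ≠ ⊤ ∧ n ≠ ⊤ ∧ (q : EReal) ≤ r - m - n := by
  lift r to ℝ using ⟨hr, (EReal.bot_lt_zero.trans_le hr').ne'⟩
  have hm' := (EReal.bot_lt_zero.trans_le hm).ne'
  have hn' := (EReal.bot_lt_zero.trans_le hn).ne'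
  have key : m + n ≠ ⊤ := (h.trans_lt (by rw [← EReal.coe_add]; exact EReal.coe_lt_top _)).ne
  have hmt : m ≠ ⊤ := by rintro rfl; exact key (EReal.top_add_of_ne_bot hn')
  have hnt : n ≠ ⊤ := by rintro rfl; exact key (EReal.add_top_of_ne_bot hm')
  refine ⟨hmt, hnt, ?_⟩
  lift m to ℝ using ⟨hmt, hm'⟩
  lift n to ℝ using ⟨hnt, hn'⟩
  norm_cast at h ⊢
  linarith

lemma ereal_sub_sub_le_of_add_le {q d r m n : EReal} (hr : 0 ≤ r) (hm : 0 ≤ m) (hn : 0 ≤ n)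
    (hd : -q ≤ d) (h : d + r ≤ m + n) : r - m - n ≤ q := by
  have hr' := (EReal.bot_lt_zero.trans_le hr).ne'
  have hm' := (EReal.bot_lt_zero.trans_le hm).ne'
  have hn' := (EReal.bot_lt_zero.trans_le hn).ne'
  induction m with
  | bot => exact absurd rfl hm'
  -- Subtracting `⊤` leaves `⊥`: primes with `M_p` or `N_p` of infinite depth contribute nothing.
  | top => simp
  | coe m =>
    induction n with
    | bot => exact absurd rfl hn'
    | top => simp
    | coe n =>
      rw [EReal.sub_le_iff_le_add (by simp) (by simp), EReal.sub_le_iff_le_add (by simp) (by simp)]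
      induction q with
      | top => simp
      -- Here all `Tor` vanish, so `d = ⊤`, which is impossible for real `m + n`.
      | bot =>
        rw [EReal.neg_bot, top_le_iff] at hd
        rw [hd, EReal.top_add_of_ne_bot hr', ← EReal.coe_add, top_le_iff] at h
        exact absurd h (EReal.coe_ne_top _)
      | coe q =>
        have h1 : ((-q : ℝ) : EReal) + r ≤ ((m + n : ℝ) : EReal) :=
          (add_le_add_left (by simpa using hd) r).trans h
        induction r with
        | bot => exact absurd rfl hr'
        | top =>
          rw [EReal.coe_add_top, top_le_iff] at h1
          exact absurd h1 (EReal.coe_ne_top _)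
        | coe r =>
          norm_cast at h1 ⊢
          linarith

end ERealLemmas

/-! ### The largest nonvanishing `Tor` -/

section TorSup

variable {R : Type u} [CommRing R] {M N : Type u} [AddCommGroup M] [Module R M]
  [AddCommGroup N] [Module R N]

lemma le_torSup {i : ℕ} (h : Nontrivial
    (((Tor (ModuleCat.{u} R) i).obj (ModuleCat.of R M)).obj (ModuleCat.of R N))) :
    ((i : ℝ) : EReal) ≤ torSup R M N :=
  le_iSup₂_of_le i h le_rfl

lemma torSup_eq_bot_or_exists (hq : torSup R M N < ⊤) : torSup R M N = ⊥ ∨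
    ∃ q : ℕ, Nontrivial
        (((Tor (ModuleCat.{u} R) q).obj (ModuleCat.of R M)).obj (ModuleCat.of R N)) ∧
      torSup R M N = ((q : ℝ) : EReal) := by
  by_cases h : ∃ i : ℕ, Nontrivial
      (((Tor (ModuleCat.{u} R) i).obj (ModuleCat.of R M)).obj (ModuleCat.of R N))
  · obtain ⟨B, hB, -⟩ := EReal.lt_iff_exists_real_btwn.1 hq
    have hb (i : ℕ) (hi : Nontrivial
        (((Tor (ModuleCat.{u} R) i).obj (ModuleCat.of R M)).obj (ModuleCat.of R N))) :
        i ≤ ⌊B⌋₊ :=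
      Nat.le_floor (EReal.coe_le_coe_iff.1 ((le_torSup hi).trans hB.le))
    classical
    obtain ⟨i, hi⟩ := h
    refine Or.inr ⟨_, Nat.findGreatest_spec (P := fun i ↦ Nontrivial
        (((Tor (ModuleCat.{u} R) i).obj (ModuleCat.of R M)).obj (ModuleCat.of R N)))
        (hb i hi) hi, le_antisymm (iSup₂_le fun j hj ↦ ?_) (le_torSup ?_)⟩
    · rw [EReal.coe_le_coe_iff, Nat.cast_le]
      exact Nat.le_findGreatest (hb j hj) hj
    · exact Nat.findGreatest_spec (P := fun i ↦ Nontrivial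
        (((Tor (ModuleCat.{u} R) i).obj (ModuleCat.of R M)).obj (ModuleCat.of R N)))
        (hb i hi) hi
  · left
    push Not at h
    refine iSup₂_eq_bot.2 fun i hi ↦ ?_
    exact absurd hi (not_nontrivial_iff_subsingleton.2 (h i))

open MonoidalCategory

variable (P : ProjectiveResolution (ModuleCat.of R M))

/-- Outside of the range determined by `torSup`, the complex `P ⊗ N` is exact. -/
lemma exists_eq_neg_of_not_exactAt {i : ℤ} (h : ¬ (((tensorRight (ModuleCat.of R
    N)).mapHomologicalComplex _).obj P.cochainComplex).ExactAt i) :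
    ∃ n : ℕ, i = -n ∧ ((n : ℝ) : EReal) ≤ torSup R M N := by
  by_cases hi : 0 < i
  · refine absurd ?_ h
    exact HomologicalComplex.ExactAt.of_isZero
      ((tensorRight (ModuleCat.of R N)).map_isZero (CochainComplex.isZero_of_isStrictlyLE _ 0 i hi))
  · obtain ⟨n, rfl⟩ := Int.exists_eq_neg_ofNat (not_lt.1 hi)
    refine ⟨n, rfl, le_torSup ?_⟩
    rw [← isZero_Tor_iff_exactAt, ModuleCat.isZero_iff_subsingleton] at h
    exact not_subsingleton_iff_nontrivial.1 h

end TorSup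

/-! ### Depth of the localized derived tensor product -/

section DerivedTensor

open MonoidalCategory

variable {R : Type u} [CommRing R] {M N : Type u} [AddCommGroup M] [Module R M]
  [AddCommGroup N] [Module R N] (P : ProjectiveResolution (ModuleCat.of R M)) (p : PrimeSpectrum R)

lemma exists_eq_neg_of_not_exactAt_derivedTensor {i : ℤ}
    (h : ¬ ((localizedResolution P p).derivedTensor (localizedComplex R N p)).ExactAt i) :
    ∃ n : ℕ, i = -n ∧ ((n : ℝ) : EReal) ≤ torSup R M N := by
  refine exists_eq_neg_of_not_exactAt P fun hT ↦ h ?_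
  refine HomologicalComplex.ExactAt.of_iso ?_ (localizedDerivedTensorIso P p).symm
  rw [HomologicalComplex.exactAt_iff_isZero_homology] at hT ⊢
  exact ((ModuleCat.localizedModuleFunctor.{u} p.asIdeal.primeCompl).map_isZero hT).of_iso
    (localizedHomologyIso p.asIdeal.primeCompl _ i)

lemma neg_torSup_le_complexDepth_derivedTensor :
    - torSup R M N ≤
      complexDepth _ ((localizedResolution P p).derivedTensor (localizedComplex R N p)) := by
  refine le_iInf₂ fun i hi ↦ ?_
  -- A nonzero `Extⁱ` forces cohomology in some degree `j ≤ i`; then `j = -n` with `n` at most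
  -- `torSup`.
  have h : ¬ ((localizedResolution P p).derivedTensor (localizedComplex R N p)).IsGE (i + 1) :=
    fun h ↦ not_nontrivial_iff_subsingleton.2
      (hyperExt_subsingleton_of_isGE _ _ h (lt_add_one i)) hi
  rw [CochainComplex.isGE_iff] at h
  push Not at h
  obtain ⟨j, hj, h⟩ := h
  obtain ⟨n, rfl, hn⟩ := exists_eq_neg_of_not_exactAt_derivedTensor P p h
  rw [EReal.neg_le]
  refine le_trans ?_ hn
  rw [← EReal.coe_neg, EReal.coe_le_coe_iff]
  exact_mod_cast (by omega : -i ≤ n)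

lemma hasBoundedHomology_derivedTensor (hq : torSup R M N < ⊤) :
    HasBoundedHomology ((localizedResolution P p).derivedTensor (localizedComplex R N p)) := by
  obtain ⟨B, hB, -⟩ := EReal.lt_iff_exists_real_btwn.1 hq
  refine ⟨-⌊B⌋₊, 0, fun i hi ↦ ?_⟩
  by_contra h
  obtain ⟨n, rfl, hn⟩ := exists_eq_neg_of_not_exactAt_derivedTensor P p h
  have : n ≤ ⌊B⌋₊ := Nat.le_floor (EReal.coe_le_coe_iff.1 (hn.trans hB.le))
  omega

lemma exists_complexDepth_derivedTensor_le [IsNoetherianRing R] {q : ℕ}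
    (hq : torSup R M N = ((q : ℝ) : EReal)) (hT : Nontrivial
      (((Tor (ModuleCat.{u} R) q).obj (ModuleCat.of R M)).obj (ModuleCat.of R N))) :
    ∃ p : PrimeSpectrum R,
      complexDepth _ ((localizedResolution P p).derivedTensor (localizedComplex R N p)) ≤
        ((-q : ℝ) : EReal) := by
  let T := ((tensorRight (ModuleCat.of R N)).mapHomologicalComplex _).obj P.cochainComplex
  have hH : Nontrivial (T.homology (-q)) := by
    rw [← not_subsingleton_iff_nontrivial, ← ModuleCat.isZero_iff_subsingleton,
      ← HomologicalComplex.exactAt_iff_isZero_homology, ← isZero_Tor_iff_exactAt,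
      ModuleCat.isZero_iff_subsingleton, not_subsingleton_iff_nontrivial]
    exact hT
  -- The prime is associated to the top `Tor`, which is the lowest cohomology of `T`.
  obtain ⟨p, y, hy, hy'⟩ := exists_killed_by_maximalIdeal (T.homology (-q))
  refine ⟨p, ?_⟩
  let e : ((localizedResolution P p).derivedTensor (localizedComplex R N p)).homology (-q) ≅
      (T.homology (-q)).localizedModule p.asIdeal.primeCompl :=
    HomologicalComplex.homologyMapIso (localizedDerivedTensorIso P p) (-q) ≪≫
      localizedHomologyIso p.asIdeal.primeCompl T (-q)
  have := complexDepth_le ((localizedResolution P p).derivedTensor (localizedComplex R N p))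
    (n := -q) ?_ (e.toLinearEquiv.symm y)
    (by rwa [Ne, LinearEquiv.map_eq_zero_iff]) (fun r hr ↦ by
      rw [← map_smul, hy' r hr, map_zero])
  · simpa using this
  · rw [CochainComplex.isGE_iff]
    intro i hi
    by_contra h
    obtain ⟨n, rfl, hn⟩ := exists_eq_neg_of_not_exactAt_derivedTensor P p h
    rw [hq, EReal.coe_le_coe_iff, Nat.cast_le] at hn
    omega

end DerivedTensor

/-! ### The two inequalities -/

section Main

variable {R : Type u} [CommRing R] {M N : Type u} [AddCommGroup M]
  [Module R M] [AddCommGroup N] [Module R N] [Module.Finite R N]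

theorem torSup_le_depthDefectSup [IsNoetherianRing R] (hq : torSup R M N < ⊤)
    (h : ∀ p : PrimeSpectrum R,
    DerivedLdepFor (Localization.AtPrime p.asIdeal) (localizedComplex R M p)) :
    torSup R M N ≤ depthDefectSup R M N := by
  obtain h0 | ⟨q, hT, hq'⟩ := torSup_eq_bot_or_exists hq
  · exact h0 ▸ bot_le
  let P : ProjectiveResolution (ModuleCat.of R M) := projectiveResolution _
  obtain ⟨p, hp⟩ := exists_complexDepth_derivedTensor_le P hq' hT
  have key := h p (localizedComplex R N p) (hasFGTerms_moduleComplex _)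
    (hasBoundedHomology_moduleComplex _) (localizedResolution P p)
    (hasBoundedHomology_derivedTensor P p hq)
  -- Besides the inequality, this gives finite depths of `M_p` and `N_p`, so both are nonzero and
  -- `p` is admissible in the supremum.
  obtain ⟨hm, hn, hle⟩ := ereal_le_sub_sub_of_add_le moduleDepth_self_ne_top
    (moduleDepth_nonneg _) (moduleDepth_nonneg _) (moduleDepth_nonneg _)
    (le_trans key (add_le_add_left hp _))
  rw [hq']
  refine hle.trans (le_iSup₂_of_le p ⟨?_, ?_⟩ le_rfl)
  · exact Module.mem_support_iff.2 (nontrivial_of_moduleDepth_ne_top hm)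
  · exact Module.mem_support_iff.2 (nontrivial_of_moduleDepth_ne_top hn)

theorem depthDefectSup_le_torSup (hq : torSup R M N < ⊤)
    (h : ∀ p : PrimeSpectrum R,
    DerivedRdepFor (Localization.AtPrime p.asIdeal) (localizedComplex R M p)) :
    depthDefectSup R M N ≤ torSup R M N := by
  refine iSup₂_le fun p _ ↦ ?_
  let P : ProjectiveResolution (ModuleCat.of R M) := projectiveResolution _
  exact ereal_sub_sub_le_of_add_le (moduleDepth_nonneg _) (moduleDepth_nonneg _)
    (moduleDepth_nonneg _) (neg_torSup_le_complexDepth_derivedTensor P p)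
    (h p (localizedComplex R N p) (hasFGTerms_moduleComplex _)
      (hasBoundedHomology_moduleComplex _) (localizedResolution P p)
      (hasBoundedHomology_derivedTensor P p hq))

end Main

/-- Let `R` be a Noetherian local ring and `M`, `N` finitely generated modules with
`q_R(M, N) < ∞`.  Each of the three assertions is made both when the derived depth condition holds
on `Spec R` for the module `M`, and when it holds for all the rings `R_𝔭`. -/
theorem theorem6p3 (R : Type u) [CommRing R] [IsLocalRing R] [IsNoetherianRing R]
    (M N : Type u) [AddCommGroup M] [Module R M] [Module.Finite R M]
    [AddCommGroup N] [Module R N] [Module.Finite R N]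
    (hq : torSup R M N < ⊤) :
    ((∀ p : PrimeSpectrum R,
        DerivedLdepFor (Localization.AtPrime p.asIdeal) (localizedComplex R M p)) →
      torSup R M N ≤ depthDefectSup R M N) ∧
    ((∀ p : PrimeSpectrum R,
        DerivedRdepFor (Localization.AtPrime p.asIdeal) (localizedComplex R M p)) →
      torSup R M N ≥ depthDefectSup R M N) ∧
    ((∀ p : PrimeSpectrum R,
        DerivedDepFor (Localization.AtPrime p.asIdeal) (localizedComplex R M p)) →
      torSup R M N = depthDefectSup R M N) ∧
    ((∀ p : PrimeSpectrum R, DerivedLdep (Localization.AtPrime p.asIdeal)) →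
      torSup R M N ≤ depthDefectSup R M N) ∧
    ((∀ p : PrimeSpectrum R, DerivedRdep (Localization.AtPrime p.asIdeal)) →
      torSup R M N ≥ depthDefectSup R M N) ∧
    ((∀ p : PrimeSpectrum R, DerivedDep (Localization.AtPrime p.asIdeal)) →
      torSup R M N = depthDefectSup R M N) := by
  have hX (p : PrimeSpectrum R) : HasFGTerms (localizedComplex R M p) :=
    hasFGTerms_moduleComplex _
  have hX' (p : PrimeSpectrum R) : HasBoundedHomology (localizedComplex R M p) :=
    hasBoundedHomology_moduleComplex _
  exact ⟨torSup_le_depthDefectSup hq, depthDefectSup_le_torSup hq,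
    fun h ↦ le_antisymm (torSup_le_depthDefectSup hq fun p ↦ (h p).1)
      (depthDefectSup_le_torSup hq fun p ↦ (h p).2),
    fun h ↦ torSup_le_depthDefectSup hq fun p ↦ h p _ (hX p) (hX' p),
    fun h ↦ depthDefectSup_le_torSup hq fun p ↦ h p _ (hX p) (hX' p),
    fun h ↦ le_antisymm (torSup_le_depthDefectSup hq fun p ↦ (h p).1 _ (hX p) (hX' p))
      (depthDefectSup_le_torSup hq fun p ↦ (h p).2 _ (hX p) (hX' p))⟩
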